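/- Let $\mathcal{C}$ be an *arithmetical category*: a Barr exact Mal'tsev category in which every internal groupoid is an equivalence relation. (Mal'tsev means: finitely complete, and every internal reflexive relation is an equivalence relation.) Two equivalence relations $R$, $S$ on an object $X$ *centralise each other* if there is a connector between them, that is, a morphism $p\colon R\times_X S\to X$, defined on triples $(x,y,z)$ with $xRy$ and $ySz$, such that $x\,S\,p(x,y,z)$, $z\,R\,p(x,y,z)$, $p(x,x,z)=z$, $p(x,y,y)=x$, $p(x,y,p(y,t,w))=p(x,t,w)$ and $p(p(x,y,t),t,w)=p(x,y,w)$ whenever these expressions are defined. Their *Smith commutator* $[R,S]^{\mathrm S}$ is the smallest equivalence relation $T$ on $X$ such that the images of $R$ and $S$ in the quotient $X/T$ centralise each other. 1. For any two equivalence relations $R$, $S$ on an object of $\mathcal{C}$, the Smith commutator exists and $[R,S]^{\mathrm S}=R\wedge S$. 2. Suppose that $\mathcal{C}$ is moreover pointed. Two morphisms $k\colon K\to D$, $l\colon L\to D$ *Huq-commute* if there is $\varphi\colon K\times L\to D$ with $\varphi\circ\langle 1_K,0\rangle=k$ and $\varphi\circ\langle 0,1_L\rangle=l$. If $A$ is an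 abelian object (that is, $1_A$ Huq-commutes with itself), then $A$ is a zero object. 3. Suppose that $\mathcal{C}$ is pointed and has binary sums. The *Higgins commutator* $[K,L]$ of subobjects $k\colon K\to D$, $l\colon L\to D$ is the image in $D$ of the kernel of the canonical morphism $K+L\to K\times L$ under the morphism $K+L\to D$ induced by $k$ and $l$. The *normalisation* of an equivalence relation $R$ on $X$ is the subobject of $X$ given by the kernel of the first projection $R\to X$ followed by the second projection $R\to X$. Then: - for all normal subobjects (kernels) $K$, $L$ of an object $D$, one has $[K,L]=K\wedge L$; - normalisation preserves binary intersections of equivalence relations; - if $\mathcal{C}$ is, in addition, protomodular (so that it is a semi-abelian category), then it satisfies the *Smith is Huq* condition: two equivalence relations on the same object centralise each other as soon as their normalisations Huq-commute. -/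

import Mathlib

open CategoryTheory CategoryTheory.Limits

universe v u

noncomputable section

namespace SmithHuq

/-! ### Barr exact, Mal'tsev and arithmetical categories -/

/-- A (Barr) exact category: a regular category in which every internal equivalence relation is
effective, i.e. the kernel pair of its quotient. -/
class BarrExact (C : Type u) [Category.{v} C] : Prop extends Regular C where
  effective : ∀ {R X : C} (p₁ p₂ : R ⟶ X), IsEquivalenceRelation p₁ p₂ →
    IsEffectiveEquivalenceRelation p₁ p₂

/-- A Mal'tsev category: a category with finite limits in which every internal reflexive relation
is an equivalence relation. -/
class Maltsev (C : Type u) [Category.{v} C] : Prop extends HasFiniteLimits C where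
  isEquivalenceRelation : ∀ {R X : C} (p₁ p₂ : R ⟶ X), Nonempty (ReflexiveRelation p₁ p₂) →
    IsEquivalenceRelation p₁ p₂

/-- An internal groupoid: objects `G₀`, arrows `G₁`, domain `d`, codomain `c`, identities `e`,
inverses `inv`, and composition `comp` of the pairs `(f, g)` of arrows with `c f = d g`
(in diagrammatic order). The associativity law is stated on generalised elements. -/
structure InternalGroupoid (C : Type u) [Category.{v} C] [HasPullbacks C] where
  G₀ : C
  G₁ : C
  d : G₁ ⟶ G₀
  c : G₁ ⟶ G₀
  e : G₀ ⟶ G₁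
  comp : pullback c d ⟶ G₁
  inv : G₁ ⟶ G₁
  e_d : e ≫ d = 𝟙 G₀
  e_c : e ≫ c = 𝟙 G₀
  comp_d : comp ≫ d = pullback.fst c d ≫ d
  comp_c : comp ≫ c = pullback.snd c d ≫ c
  inv_d : inv ≫ d = c
  inv_c : inv ≫ c = d
  id_comp : pullback.lift (d ≫ e) (𝟙 G₁) (by simp [e_c]) ≫ comp = 𝟙 G₁
  comp_id : pullback.lift (𝟙 G₁) (c ≫ e) (by simp [e_d]) ≫ comp = 𝟙 G₁
  comp_inv : pullback.lift (𝟙 G₁) inv (by simp [inv_d]) ≫ comp = d ≫ e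
  inv_comp : pullback.lift inv (𝟙 G₁) (by simp [inv_c]) ≫ comp = c ≫ e
  assoc : ∀ {T : C} (f g h : T ⟶ G₁) (hfg : f ≫ c = g ≫ d) (hgh : g ≫ c = h ≫ d),
    pullback.lift (pullback.lift f g hfg ≫ comp) h (by rw [Category.assoc, comp_c, ← Category.assoc, pullback.lift_snd, hgh]) ≫ comp =
      pullback.lift f (pullback.lift g h hgh ≫ comp) (by rw [Category.assoc, comp_d, ← Category.assoc, pullback.lift_fst, hfg]) ≫ comp

/-- An arithmetical category: an exact Mal'tsev category in which every internal groupoid is an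
equivalence relation. -/
class Arithmetical (C : Type u) [Category.{v} C] : Prop extends BarrExact C, Maltsev C where
  groupoid : ∀ G : InternalGroupoid C, IsEquivalenceRelation G.d G.c

/-! ### Relations as subobjects of `X ⨯ X` -/

section Relations

variable {C : Type u} [Category.{v} C] [HasFiniteLimits C] {X : C}

/-- First projection of a relation. -/
abbrev relFst (R : Subobject (X ⨯ X)) : (R : C) ⟶ X := R.arrow ≫ prod.fst

/-- Second projection of a relation. -/
abbrev relSnd (R : Subobject (X ⨯ X)) : (R : C) ⟶ X := R.arrow ≫ prod.snd

/-- The subobject `R` of `X ⨯ X` is an internal equivalence relation on `X`. -/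
def IsEquivRel (R : Subobject (X ⨯ X)) : Prop := IsEquivalenceRelation (relFst R) (relSnd R)

/-- `x R y` for generalised elements `x y : T ⟶ X`. -/
abbrev Related (R : Subobject (X ⨯ X)) {T : C} (x y : T ⟶ X) : Prop := R.Factors (prod.lift x y)

/-- The object `R ×_X S` of triples `(x, y, z)` with `x R y` and `y S z`. -/
abbrev Triples (R S : Subobject (X ⨯ X)) : C := pullback (relSnd R) (relFst S)

/-- The generalised element `(x, y, z)` of `R ×_X S`. -/
def triple {R S : Subobject (X ⨯ X)} {T : C} (x y z : T ⟶ X) (hxy : Related R x y)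
    (hyz : Related S y z) : T ⟶ Triples R S :=
  pullback.lift (R.factorThru (prod.lift x y) hxy) (S.factorThru (prod.lift y z) hyz)
    (by simp [prod.lift_fst, prod.lift_snd])

/-- `p : R ×_X S ⟶ X` is a connector between the equivalence relations `R` and `S`. -/
structure IsConnector (R S : Subobject (X ⨯ X)) (p : Triples R S ⟶ X) : Prop where
  related_left : ∀ {T : C} (x y z : T ⟶ X) (hxy : Related R x y) (hyz : Related S y z),
    Related S x (triple x y z hxy hyz ≫ p)
  related_right : ∀ {T : C} (x y z : T ⟶ X) (hxy : Related R x y) (hyz : Related S y z),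
    Related R z (triple x y z hxy hyz ≫ p)
  left_id : ∀ {T : C} (x z : T ⟶ X) (hxx : Related R x x) (hxz : Related S x z),
    triple x x z hxx hxz ≫ p = z
  right_id : ∀ {T : C} (x y : T ⟶ X) (hxy : Related R x y) (hyy : Related S y y),
    triple x y y hxy hyy ≫ p = x
  /-- `p(x, y, p(y, t, w)) = p(x, t, w)` -/
  assoc_left : ∀ {T : C} (x y t w : T ⟶ X) (hxy : Related R x y) (hyt : Related R y t)
    (htw : Related S t w) (hxt : Related R x t) (hy : Related S y (triple y t w hyt htw ≫ p)),
    triple x y (triple y t w hyt htw ≫ p) hxy hy ≫ p = triple x t w hxt htw ≫ p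
  /-- `p(p(x, y, t), t, w) = p(x, y, w)` -/
  assoc_right : ∀ {T : C} (x y t w : T ⟶ X) (hxy : Related R x y) (hyt : Related S y t)
    (htw : Related S t w) (hyw : Related S y w) (ht : Related R (triple x y t hxy hyt ≫ p) t),
    triple (triple x y t hxy hyt ≫ p) t w ht htw ≫ p = triple x y w hxy hyw ≫ p

/-- `R` and `S` centralise each other (commute in the sense of Smith). -/
def Centralise (R S : Subobject (X ⨯ X)) : Prop := ∃ p : Triples R S ⟶ X, IsConnector R S p

end Relations

section Smith

variable {C : Type u} [Category.{v} C] [Regular C] {X : C}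

/-- The image of a relation `R` on `X` along `q : X ⟶ Y`, a relation on `Y`. -/
def directImage {Y : C} (q : X ⟶ Y) (R : Subobject (X ⨯ X)) : Subobject (Y ⨯ Y) :=
  imageSubobject (R.arrow ≫ prod.map q q)

/-- The images of `R` and `S` in the quotient of `X` by `T` centralise each other. -/
def CentraliseModulo (R S T : Subobject (X ⨯ X)) : Prop :=
  ∃ (Y : C) (q : X ⟶ Y), IsRegularEpi q ∧ IsKernelPair q (relFst T) (relSnd T) ∧
    Centralise (directImage q R) (directImage q S)

/-- `T` is the Smith commutator of the equivalence relations `R` and `S` on `X`: the smallest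
equivalence relation on `X` modulo which `R` and `S` centralise each other. -/
def IsSmithCommutator (R S T : Subobject (X ⨯ X)) : Prop :=
  IsLeast {T' : Subobject (X ⨯ X) | IsEquivRel T' ∧ CentraliseModulo R S T'} T

end Smith

/-! ### Pointed notions -/

section Pointed

variable {C : Type u} [Category.{v} C] [HasZeroMorphisms C]

/-- The arrows `k` and `l` commute in the sense of Huq. -/
def HuqCommute [HasBinaryProducts C] {K L D : C} (k : K ⟶ D) (l : L ⟶ D) : Prop :=
  ∃ φ : K ⨯ L ⟶ D, prod.lift (𝟙 K) 0 ≫ φ = k ∧ prod.lift 0 (𝟙 L) ≫ φ = l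

/-- An abelian object (in a pointed Mal'tsev category): one whose identity Huq-commutes with
itself. -/
def IsAbelianObject [HasBinaryProducts C] (A : C) : Prop := HuqCommute (𝟙 A) (𝟙 A)

/-- A normal subobject: the kernel of some arrow. -/
def IsNormalSubobject [HasKernels C] {D : C} (K : Subobject D) : Prop :=
  ∃ (E : C) (f : D ⟶ E), K = kernelSubobject f

/-- The normalisation of a relation `R` on `X`: the inverse image of `R` along
`⟨0, 1⟩ : X ⟶ X ⨯ X`, i.e. the kernel of the first projection of `R`, included in `X` by the
second projection. -/
def normalisation [HasFiniteLimits C] {X : C} (R : Subobject (X ⨯ X)) : Subobject X :=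
  (Subobject.pullback (prod.lift 0 (𝟙 X))).obj R

/-- The Higgins commutator `[K, L]` of two subobjects of `D`: the image of the composite
`K ⋄ L ⟶ K ⨿ L ⟶ D`, where `K ⋄ L` is the kernel of the comparison `K ⨿ L ⟶ K ⨯ L`. -/
def higginsCommutator [Regular C] [HasBinaryCoproducts C] {D : C} (K L : Subobject D) :
    Subobject D :=
  imageSubobject
    (kernel.ι (coprod.desc (prod.lift (𝟙 (K : C)) (0 : (K : C) ⟶ (L : C)))
      (prod.lift (0 : (L : C) ⟶ (K : C)) (𝟙 (L : C)))) ≫ coprod.desc K.arrow L.arrow)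

/-- The *Smith is Huq* condition: equivalence relations centralise each other as soon as their
normalisations Huq-commute. -/
def SmithIsHuq (C : Type u) [Category.{v} C] [HasZeroMorphisms C] [HasFiniteLimits C] : Prop :=
  ∀ {X : C} (R S : Subobject (X ⨯ X)), IsEquivRel R → IsEquivRel S →
    HuqCommute (normalisation R).arrow (normalisation S).arrow → Centralise R S

end Pointed

/-- Protomodularity: the change-of-base functors `p^* : Pt_B ⥤ Pt_E` between the categories of
points (split epimorphisms with chosen section) reflect isomorphisms. -/
def Protomodular (C : Type u) [Category.{v} C] [HasPullbacks C] : Prop :=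
  ∀ {E B A A' : C} (p : E ⟶ B) (f : A ⟶ B) (s : B ⟶ A) (f' : A' ⟶ B) (s' : B ⟶ A')
    (_ : s ≫ f = 𝟙 B) (_ : s' ≫ f' = 𝟙 B) (h : A ⟶ A') (hf : h ≫ f' = f) (_ : s ≫ h = s'),
    IsIso (pullback.map p f p f' (𝟙 E) h (𝟙 B) (by simp) (by simp [hf])) → IsIso h

end SmithHuq

end

namespace SmithHuq

attribute [local simp] prod.lift_fst prod.lift_snd pullback.lift_fst pullback.lift_snd
  prod.lift_fst_assoc prod.lift_snd_assoc pullback.lift_fst_assoc pullback.lift_snd_assoc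

/-! ### Relations as subobjects, handled through generalised elements -/

section Relations

variable {C : Type u} [Category.{v} C]

/-! Everything rests on one collapse: a bundle of groups is an internal groupoid with equal domain
and codomain, so arithmeticity makes its projection monic (`mono_of_fibrewise_group`). A connector
between `R` and `S` turns each class of `R ⊓ S` into a group under `p(y, x, z)`, with `x` as unit.
Hence centralising relations meet in the diagonal; conversely, the Mal'tsev axiom builds a connector
whenever they do (`centralise_of_inf_trivial`). Passing to quotients identifies the Smith commutator
with `R ⊓ S`. In the pointed case an abelian object is a group over the zero object, hence zero. For
Higgins commutators the hard inclusion is `K ⊓ L ≤ [K, L]`: by `factors_zero_of_factors`, the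
obstruction to it is a quotient of `K ⊓ L` carrying an addition, and such a quotient vanishes. For
Smith is Huq, Huq-commuting normalisations have abelian, hence zero, intersection. This is the
normalisation of `R ⊓ S`, normalisation being an inverse image; protomodularity then makes `R ⊓ S`
discrete, and a connector exists. -/

theorem factors_of_strongEpi_comp {S T X : C} {M : Subobject X} {e : S ⟶ T} [StrongEpi e]
    {f : T ⟶ X} (h : M.Factors (e ≫ f)) : M.Factors f := by
  have sq : CommSq (M.factorThru _ h) e M.arrow f := ⟨by simp⟩
  rw [← sq.fac_right]
  exact Subobject.factors_comp_arrow _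

variable [HasFiniteLimits C]

theorem Related.comp {X Y S T : C} {M : Subobject (X ⨯ Y)} {x : T ⟶ X} {y : T ⟶ Y}
    (h : M.Factors (prod.lift x y)) (u : S ⟶ T) : M.Factors (prod.lift (u ≫ x) (u ≫ y)) := by
  rw [← prod.comp_lift]
  exact Subobject.factors_of_factors_right _ h

theorem factors_lift_arrow {X Y T : C} (M : Subobject (X ⨯ Y)) (f : T ⟶ M) :
    M.Factors (prod.lift (f ≫ M.arrow ≫ prod.fst) (f ≫ M.arrow ≫ prod.snd)) := by
  have : prod.lift (f ≫ M.arrow ≫ prod.fst) (f ≫ M.arrow ≫ prod.snd) = f ≫ M.arrow := by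
    ext <;> simp
  rw [this]
  exact Subobject.factors_comp_arrow _

theorem rel_hom_ext {X Y T : C} {M : Subobject (X ⨯ Y)} {f g : T ⟶ M}
    (h₁ : f ≫ M.arrow ≫ prod.fst = g ≫ M.arrow ≫ prod.fst)
    (h₂ : f ≫ M.arrow ≫ prod.snd = g ≫ M.arrow ≫ prod.snd) : f = g := by
  rw [← cancel_mono M.arrow]
  ext <;> simpa

namespace IsEquivRel

variable {X : C} {R S : Subobject (X ⨯ X)}

theorem refl (hR : IsEquivRel R) {T : C} (x : T ⟶ X) : Related R x x := by
  obtain ⟨⟨E⟩⟩ := hR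
  have := factors_lift_arrow R (x ≫ E.r)
  simpa using this

theorem symm (hR : IsEquivRel R) {T : C} {x y : T ⟶ X} (h : Related R x y) : Related R y x := by
  obtain ⟨⟨E⟩⟩ := hR
  have := factors_lift_arrow R (R.factorThru _ h ≫ E.s)
  simpa [E.symmetry₁, E.symmetry₂] using this

theorem trans (hR : IsEquivRel R) {T : C} {x y z : T ⟶ X} (h : Related R x y)
    (h' : Related R y z) : Related R x z := by
  obtain ⟨⟨E⟩⟩ := hR
  obtain ⟨l, hl₁, hl₂⟩ := PullbackCone.IsLimit.lift' E.isLimit (R.factorThru _ h)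
    (R.factorThru _ h') (by simp)
  have := factors_lift_arrow R (l ≫ E.t)
  simpa [E.transitivity₁, E.transitivity₂, reassoc_of% hl₁, reassoc_of% hl₂] using this

end IsEquivRel

end Relations

/-! ### Consequences of the Mal'tsev axiom: difunctionality and connectors -/

section Maltsev

variable {C : Type u} [Category.{v} C] [Maltsev C]

theorem isEquivRel_of_related_id {X : C} {R : Subobject (X ⨯ X)} (h : Related R (𝟙 X) (𝟙 X)) :
    IsEquivRel R :=
  Maltsev.isEquivalenceRelation _ _
    ⟨{ right_cancellation := fun _ _ _ h₁ h₂ => rel_hom_ext h₁ h₂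
       r := R.factorThru _ h
       reflexivity₁ := by simp
       reflexivity₂ := by simp }⟩

theorem IsEquivRel.inf {X : C} {R S : Subobject (X ⨯ X)} (hR : IsEquivRel R) (hS : IsEquivRel S) :
    IsEquivRel (R ⊓ S) :=
  isEquivRel_of_related_id ((Subobject.inf_factors _).2 ⟨hR.refl _, hS.refl _⟩)

/-- Relations in a Mal'tsev category are difunctional. -/
theorem difunctional {A B T : C} {M : Subobject (A ⨯ B)} {a c : T ⟶ A} {b d : T ⟶ B}
    (hab : M.Factors (prod.lift a b)) (hcb : M.Factors (prod.lift c b))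
    (hcd : M.Factors (prod.lift c d)) : M.Factors (prod.lift a d) := by
  -- `E` relates two members of `M` when the first coordinate of one is `M`-related to the second
  -- coordinate of the other. It is reflexive, and its symmetry is difunctionality.
  let E : Subobject ((M : C) ⨯ (M : C)) :=
    (Subobject.pullback (prod.map (M.arrow ≫ prod.fst) (M.arrow ≫ prod.snd))).obj M
  have key : ∀ {S : C} (m n : S ⟶ M), Related E m n ↔
      M.Factors (prod.lift (m ≫ M.arrow ≫ prod.fst) (n ≫ M.arrow ≫ prod.snd)) := fun m n => by
    rw [Related, pullback_factors_iff, prod.lift_map]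
  have hE : IsEquivRel E := isEquivRel_of_related_id ((key _ _).2 (factors_lift_arrow M (𝟙 _)))
  have h := (key _ _).1 (hE.symm ((key (M.factorThru _ hcd) (M.factorThru _ hab)).2 (by simpa)))
  simpa using h

/-- Equivalence relations with trivial intersection centralise each other. -/
theorem centralise_of_inf_trivial {X : C} {R S : Subobject (X ⨯ X)} (hR : IsEquivRel R)
    (hS : IsEquivRel S)
    (h : ∀ {T : C} (x y : T ⟶ X), Related R x y → Related S x y → x = y) : Centralise R S := by
  let a : Triples R S ⟶ X := pullback.fst _ _ ≫ relFst R
  let b : Triples R S ⟶ X := pullback.snd _ _ ≫ relSnd S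
  let m : Triples R S ⟶ X := pullback.fst _ _ ≫ relSnd R
  have hm : m = pullback.snd _ _ ≫ relFst S := pullback.condition
  have ham : Related R a m := factors_lift_arrow R _
  have hmb : Related S m b := hm ▸ factors_lift_arrow S _
  -- Two middle terms for the same outer terms are both `R`- and `S`-related, so triples form a
  -- relation on `X`, which is reflexive and hence symmetric.
  have jm : ∀ {T : C} (f g : T ⟶ Triples R S), f ≫ a = g ≫ a → f ≫ b = g ≫ b → f = g := by
    intro T f g h₁ h₂
    have h₃ : f ≫ m = g ≫ m := h _ _
      (hR.trans (hR.symm (Related.comp ham f)) (h₁ ▸ Related.comp ham g))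
      (hS.trans (Related.comp hmb f) (h₂ ▸ hS.symm (Related.comp hmb g)))
    apply pullback.hom_ext <;> apply rel_hom_ext
    · simpa [a] using h₁
    · simpa [m] using h₃
    · simpa [hm] using h₃
    · simpa [b] using h₂
  have hE : IsEquivalenceRelation a b := Maltsev.isEquivalenceRelation _ _
    ⟨{ right_cancellation := fun _ f g h₁ h₂ => jm f g h₁ h₂
       r := triple (𝟙 X) (𝟙 X) (𝟙 X) (hR.refl _) (hS.refl _)
       reflexivity₁ := by simp [a, triple]
       reflexivity₂ := by simp [b, triple] }⟩
  obtain ⟨⟨E⟩⟩ := hE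
  have hl : ∀ {T : C} (x y z : T ⟶ X) (hxy : Related R x y) (hyz : Related S y z),
      Related S x (triple x y z hxy hyz ≫ E.s ≫ m) := by
    intro T x y z hxy hyz
    have := hS.symm (Related.comp hmb (triple x y z hxy hyz ≫ E.s))
    simpa [E.symmetry₂, a, triple] using this
  have hr : ∀ {T : C} (x y z : T ⟶ X) (hxy : Related R x y) (hyz : Related S y z),
      Related R z (triple x y z hxy hyz ≫ E.s ≫ m) := by
    intro T x y z hxy hyz
    have := Related.comp ham (triple x y z hxy hyz ≫ E.s)
    simpa [E.symmetry₁, b, triple] using this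
  -- Symmetry sends `(x, y, z)` to a triple `(z, w, x)`, and `p(x, y, z)` is `w`. Each identity
  -- holds because its two sides are related by both `R` and `S`.
  refine ⟨E.s ≫ m, fun x y z hxy hyz => hl x y z hxy hyz, fun x y z hxy hyz => hr x y z hxy hyz,
    fun x z hxx hxz => ?_, fun x y hxy hyy => ?_, fun x y t w hxy hyt htw hxt hy => ?_,
    fun x y t w hxy hyt htw hyw ht => ?_⟩
  · exact (h _ _ (hr _ _ _ hxx hxz) (hS.trans (hS.symm hxz) (hl _ _ _ hxx hxz))).symm
  · exact (h _ _ (hR.trans hxy (hr _ _ _ hxy hyy)) (hl _ _ _ hxy hyy)).symm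
  · exact h _ _
      (hR.trans (hR.symm (hr _ _ _ hxy hy))
        (hR.trans (hR.symm (hr _ _ _ hyt htw)) (hr _ _ _ hxt htw)))
      (hS.trans (hS.symm (hl _ _ _ hxy hy)) (hl _ _ _ hxt htw))
  · exact h _ _
      (hR.trans (hR.symm (hr _ _ _ ht htw)) (hr _ _ _ hxy hyw))
      (hS.trans (hS.symm (hl _ _ _ ht htw))
        (hS.trans (hS.symm (hl _ _ _ hxy hyt)) (hl _ _ _ hxy hyw)))

end Maltsev

/-! ### Collapse of bundles of groups and of centralising relations -/

section Groupoids

variable {C : Type u} [Category.{v} C] [Arithmetical C]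

/-- In an arithmetical category every bundle of groups is trivial. The group operations on the
fibres of `d` are given on generalised elements. -/
theorem mono_of_fibrewise_group {Y G : C} (d : G ⟶ Y) (e : Y ⟶ G) (inv : G ⟶ G)
    (mul : ∀ {T : C} (f g : T ⟶ G), f ≫ d = g ≫ d → (T ⟶ G))
    (comp_mul : ∀ {S T : C} (u : S ⟶ T) (f g : T ⟶ G) (h : f ≫ d = g ≫ d),
      u ≫ mul f g h = mul (u ≫ f) (u ≫ g) (by simp [h]))
    (e_d : e ≫ d = 𝟙 Y) (inv_d : inv ≫ d = d)
    (mul_d : ∀ {T : C} (f g : T ⟶ G) (h : f ≫ d = g ≫ d), mul f g h ≫ d = f ≫ d)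
    (one_mul : mul (d ≫ e) (𝟙 G) (by simp [e_d]) = 𝟙 G)
    (mul_one : mul (𝟙 G) (d ≫ e) (by simp [e_d]) = 𝟙 G)
    (mul_inv : mul (𝟙 G) inv (by simp [inv_d]) = d ≫ e)
    (inv_mul : mul inv (𝟙 G) (by simp [inv_d]) = d ≫ e)
    (assoc : ∀ {T : C} (f g k : T ⟶ G) (hfg : f ≫ d = g ≫ d) (hgk : g ≫ d = k ≫ d),
      mul (mul f g hfg) k (by rw [mul_d, hfg, hgk]) =
        mul f (mul g k hgk) (by rw [mul_d, hfg])) : Mono d := by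
  have key : ∀ {T : C} (f g : T ⟶ G) (h : f ≫ d = g ≫ d),
      pullback.lift f g h ≫ mul (pullback.fst d d) (pullback.snd d d) pullback.condition =
        mul f g h := by
    intro T f g h
    rw [comp_mul]
    simp
  let 𝒢 : InternalGroupoid C :=
    { G₀ := Y
      G₁ := G
      d := d
      c := d
      e := e
      comp := mul (pullback.fst d d) (pullback.snd d d) pullback.condition
      inv := inv
      e_d := e_d
      e_c := e_d
      comp_d := mul_d _ _ _
      comp_c := (mul_d _ _ _).trans pullback.condition
      inv_d := inv_d
      inv_c := inv_d
      id_comp := by rw [key, one_mul]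
      comp_id := by rw [key, mul_one]
      comp_inv := by rw [key, mul_inv]
      inv_comp := by rw [key, inv_mul]
      assoc := fun f g h hfg hgh => by
        simp only [key]
        exact assoc f g h hfg hgh }
  obtain ⟨⟨E⟩⟩ := Arithmetical.groupoid 𝒢
  -- Domain and codomain are both `d`, so their joint monicity is monicity of `d`.
  exact ⟨fun f g h => E.right_cancellation f g h h⟩

theorem comp_triple {X S T : C} {R S' : Subobject (X ⨯ X)} (u : S ⟶ T) (x y z : T ⟶ X)
    (hxy : Related R x y) (hyz : Related S' y z) :
    u ≫ triple x y z hxy hyz =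
      triple (u ≫ x) (u ≫ y) (u ≫ z) (Related.comp hxy u) (Related.comp hyz u) := by
  apply pullback.hom_ext <;> apply rel_hom_ext <;> simp [triple]

/-- Equivalence relations which centralise each other have trivial intersection. -/
theorem Centralise.eq_of_related {X : C} {R S : Subobject (X ⨯ X)} (hR : IsEquivRel R)
    (hS : IsEquivRel S) (h : Centralise R S) {T : C} {x y : T ⟶ X} (hxR : Related R x y)
    (hxS : Related S x y) : x = y := by
  obtain ⟨p, hp⟩ := h
  have hW := hR.inf hS
  have l : ∀ {T : C} {x y : T ⟶ X}, Related (R ⊓ S) x y → Related R x y :=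
    fun h => Subobject.factors_left_of_inf_factors h
  have r : ∀ {T : C} {x y : T ⟶ X}, Related (R ⊓ S) x y → Related S x y :=
    fun h => Subobject.factors_right_of_inf_factors h
  have rel : ∀ {T : C} (x y z : T ⟶ X) (hyx : Related (R ⊓ S) y x) (hxz : Related (R ⊓ S) x z),
      Related (R ⊓ S) x (triple y x z (l hyx) (r hxz) ≫ p) := fun x y z hyx hxz =>
    (Subobject.inf_factors _).2 ⟨hR.trans (l hxz) (hp.related_right _ _ _ _ _),
      hS.trans (hS.symm (r hyx)) (hp.related_left _ _ _ _ _)⟩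
  have el : ∀ {T : C} (f : T ⟶ (R ⊓ S : Subobject (X ⨯ X))),
      Related (R ⊓ S) (f ≫ relFst (R ⊓ S)) (f ≫ relSnd (R ⊓ S)) := factors_lift_arrow _
  have hm : Mono (relFst (R ⊓ S)) := by
    have hid := el (𝟙 _)
    simp only [Category.id_comp] at hid
    -- The inverse of `y` in the group based at `x` is `p(x, y, x)`.
    have inv_rel : Related (R ⊓ S) (relFst (R ⊓ S)) (triple (relFst (R ⊓ S)) (relSnd (R ⊓ S))
        (relFst (R ⊓ S)) (l hid) (r (hW.symm hid)) ≫ p) :=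
      (Subobject.inf_factors _).2
        ⟨hp.related_right _ _ _ _ _, hp.related_left _ _ _ _ _⟩
    refine mono_of_fibrewise_group (relFst (R ⊓ S)) ((R ⊓ S).factorThru _ (hW.refl (𝟙 X)))
      ((R ⊓ S).factorThru _ inv_rel)
      (fun f g h => (R ⊓ S).factorThru _ (rel (f ≫ relFst (R ⊓ S)) (f ≫ relSnd (R ⊓ S))
        (g ≫ relSnd (R ⊓ S)) (hW.symm (el f)) (h ▸ el g))) ?_ ?_ ?_ ?_ ?_ ?_ ?_ ?_ ?_
    · intro S T u f g h
      apply rel_hom_ext <;> simp [reassoc_of% @comp_triple]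
    · simp
    · simp
    · simp
    · apply rel_hom_ext <;> simp [hp.left_id]
    · apply rel_hom_ext <;> simp [hp.right_id]
    · apply rel_hom_ext
      · simp
      · simpa using (hp.assoc_left _ _ _ _ (l (hW.symm hid)) (l hid) (r (hW.symm hid))
          (l (hW.refl _)) _).trans (hp.left_id _ _ _ _)
    · apply rel_hom_ext
      · simp
      · simpa using (hp.assoc_right _ _ _ _ (l hid) (r (hW.symm hid)) (r hid)
          (r (hW.refl _)) _).trans (hp.right_id _ _ _ _)
    · intro T f g k hfg hgk
      have hf := hW.symm (el f)
      have hg := hfg ▸ el g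
      have hk := (hfg.trans hgk) ▸ el k
      have hP := rel _ _ _ hf hg
      have hQ := rel _ _ _ (hW.symm hg) hk
      -- Over the base point `x`, both bracketings equal `p(p(f, x, g), g, p(g, x, k))`.
      have h := (hp.assoc_left _ _ _ _ (l (hW.trans (hW.symm hP) hg)) (l (hW.symm hg)) (r hk)
        (l (hW.symm hP)) (r (hW.trans (hW.symm hg) hQ))).symm.trans
        (hp.assoc_right _ _ _ _ _ _ _ (r hQ) _)
      apply rel_hom_ext
      · simp
      · simpa [← hfg] using h
  have hW' : Related (R ⊓ S) x y := (Subobject.inf_factors _).2 ⟨hxR, hxS⟩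
  have : (R ⊓ S).factorThru _ hW' = (R ⊓ S).factorThru _ (hW.refl x) := by
    rw [← cancel_mono (relFst (R ⊓ S))]
    simp
  simpa using (congrArg (· ≫ relSnd (R ⊓ S)) this).symm

end Groupoids

/-! ### Images, covers and descent in regular categories -/

section Regular

variable {C : Type u} [Category.{v} C] [Regular C]

theorem isRegularEpi_of_strongEpi {X Y : C} (f : X ⟶ Y) [StrongEpi f] : IsRegularEpi f :=
  inferInstance

theorem exists_strongEpi_lift {X Y T : C} (q : X ⟶ Y) [StrongEpi q] (y : T ⟶ Y) :
    ∃ (S : C) (e : S ⟶ T) (x : S ⟶ X), StrongEpi e ∧ x ≫ q = e ≫ y := by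
  have := isRegularEpi_of_strongEpi q
  exact ⟨_, pullback.fst y q, pullback.snd y q, inferInstance, pullback.condition.symm⟩

/-- Images are existential quantifiers, with witnesses found after passing to a cover: strong
epimorphisms are regular here, and those are stable under pullback. -/
theorem factors_imageSubobject_iff {X Y T : C} (f : X ⟶ Y) (y : T ⟶ Y) :
    (imageSubobject f).Factors y ↔
      ∃ (S : C) (e : S ⟶ T) (x : S ⟶ X), StrongEpi e ∧ x ≫ f = e ≫ y := by
  constructor
  · intro h
    have : StrongEpi (factorThruImageSubobject f) := strongEpi_comp _ _
    obtain ⟨S, e, x, he, hx⟩ :=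
      exists_strongEpi_lift (factorThruImageSubobject f) ((imageSubobject f).factorThru y h)
    refine ⟨S, e, x, he, ?_⟩
    have := congrArg (· ≫ (imageSubobject f).arrow) hx
    simpa using this
  · rintro ⟨S, e, x, he, hx⟩
    exact factors_of_strongEpi_comp (hx ▸ imageSubobject_factors_comp_self f x)

theorem related_directImage_iff {X Y T : C} (q : X ⟶ Y) (R : Subobject (X ⨯ X)) (u v : T ⟶ Y) :
    Related (directImage q R) u v ↔ ∃ (S : C) (e : S ⟶ T) (x y : S ⟶ X), StrongEpi e ∧
      Related R x y ∧ x ≫ q = e ≫ u ∧ y ≫ q = e ≫ v := by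
  rw [Related, directImage, factors_imageSubobject_iff]
  constructor
  · rintro ⟨S, e, r, he, hr⟩
    refine ⟨S, e, r ≫ relFst R, r ≫ relSnd R, he, factors_lift_arrow R r, ?_, ?_⟩
    · simpa using congrArg (· ≫ prod.fst) hr
    · simpa using congrArg (· ≫ prod.snd) hr
  · rintro ⟨S, e, x, y, he, hr, hx, hy⟩
    refine ⟨S, e, R.factorThru _ hr, he, ?_⟩
    ext <;> simp [hx, hy]

theorem directImage_refl {X Y : C} (q : X ⟶ Y) [StrongEpi q] {R : Subobject (X ⨯ X)}
    (hR : IsEquivRel R) : Related (directImage q R) (𝟙 Y) (𝟙 Y) :=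
  (related_directImage_iff _ _ _ _).2
    ⟨X, q, 𝟙 X, 𝟙 X, inferInstance, hR.refl _, by simp, by simp⟩

theorem related_of_isKernelPair {X Y T : C} {q : X ⟶ Y} {R : Subobject (X ⨯ X)}
    (h : IsKernelPair q (relFst R) (relSnd R)) {x y : T ⟶ X} :
    Related R x y ↔ x ≫ q = y ≫ q := by
  constructor
  · intro hr
    have := congrArg (R.factorThru _ hr ≫ ·) h.w
    simpa using this
  · intro hxy
    have := factors_lift_arrow R (h.lift x y hxy)
    have h₁ := h.lift_fst x y hxy
    have h₂ := h.lift_snd x y hxy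
    dsimp only [relFst, relSnd] at h₁ h₂
    simpa only [h₁, h₂] using this

/-- A relation containing the kernel pair of `q` is the inverse image of its image along `q`. -/
theorem related_of_directImage {X Y T : C} {q : X ⟶ Y} {R K : Subobject (X ⨯ X)}
    (hR : IsEquivRel R) (hK : IsKernelPair q (relFst K) (relSnd K)) (hKR : K ≤ R) {x y : T ⟶ X}
    (h : Related (directImage q R) (x ≫ q) (y ≫ q)) : Related R x y := by
  obtain ⟨S, e, x', y', he, hr, hx, hy⟩ := (related_directImage_iff _ _ _ _).1 h
  have h₁ : Related R (e ≫ x) x' := Subobject.factors_of_le _ hKR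
    ((related_of_isKernelPair hK).2 (by simpa using hx.symm))
  have h₂ : Related R y' (e ≫ y) := Subobject.factors_of_le _ hKR
    ((related_of_isKernelPair hK).2 (by simpa using hy))
  refine factors_of_strongEpi_comp (e := e) ?_
  rw [prod.comp_lift]
  exact hR.trans h₁ (hR.trans hr h₂)

theorem exists_desc_of_strongEpi {X Y Z : C} (q : X ⟶ Y) [StrongEpi q] (f : X ⟶ Z)
    (h : ∀ {T : C} (x y : T ⟶ X), x ≫ q = y ≫ q → x ≫ f = y ≫ f) : ∃ g : Y ⟶ Z, q ≫ g = f :=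
  have := isRegularEpi_of_strongEpi q
  IsRegularEpi.exists_of_isKernelPair q (IsKernelPair.of_hasPullback q) f
    (h _ _ pullback.condition)

instance strongEpi_prod_map_id {X Y Z : C} (f : X ⟶ Y) [StrongEpi f] :
    StrongEpi (prod.map f (𝟙 Z)) := by
  have := isRegularEpi_of_strongEpi f
  have : IsRegularEpi (prod.map f (𝟙 Z)) :=
    Regular.regularEpiIsStableUnderBaseChange.of_isPullback
      (IsPullback.of_prod_fst_with_id f Z) this
  infer_instance

instance strongEpi_prod_map {X Y X' Y' : C} (f : X ⟶ Y) (g : X' ⟶ Y') [StrongEpi f]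
    [StrongEpi g] : StrongEpi (prod.map f g) := by
  have h : prod.map f g = prod.map f (𝟙 X') ≫
      ((prod.braiding Y X').hom ≫ prod.map g (𝟙 Y)) ≫ (prod.braiding Y' Y).hom := by
    ext <;> simp
  rw [h]
  have := strongEpi_comp (prod.braiding Y X').hom (prod.map g (𝟙 Y))
  have := strongEpi_comp ((prod.braiding Y X').hom ≫ prod.map g (𝟙 Y)) (prod.braiding Y' Y).hom
  exact strongEpi_comp _ _

end Regular

section Exact

theorem exists_quotient {C : Type u} [Category.{v} C] [BarrExact C] {X : C}
    {R : Subobject (X ⨯ X)} (hR : IsEquivRel R) :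
    ∃ (Y : C) (q : X ⟶ Y), IsRegularEpi q ∧ IsKernelPair q (relFst R) (relSnd R) := by
  obtain ⟨⟨E⟩⟩ := BarrExact.effective _ _ hR
  exact ⟨E.B, E.π, inferInstance, E.isKernelPair⟩

end Exact

/-! ### The Smith commutator -/

section Smith

variable {C : Type u} [Category.{v} C] [Arithmetical C]

theorem isSmithCommutator_inf {X : C} {R S : Subobject (X ⨯ X)} (hR : IsEquivRel R)
    (hS : IsEquivRel S) : IsSmithCommutator R S (R ⊓ S) := by
  constructor
  · refine ⟨hR.inf hS, ?_⟩
    obtain ⟨Y, q, hq, hK⟩ := exists_quotient (hR.inf hS)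
    refine ⟨Y, q, hq, hK, centralise_of_inf_trivial
      (isEquivRel_of_related_id (directImage_refl q hR))
      (isEquivRel_of_related_id (directImage_refl q hS)) fun u v hu hv => ?_⟩
    -- Lift `u` and `v` to `X` over a common cover. Since `R` and `S` contain the kernel pair of
    -- `q`, the lifts are related by both, hence identified by `q`.
    obtain ⟨S₁, e₁, x, he₁, hx⟩ := exists_strongEpi_lift q u
    obtain ⟨S₂, e₂, y, he₂, hy⟩ := exists_strongEpi_lift q (e₁ ≫ v)
    have hx' : (e₂ ≫ x) ≫ q = (e₂ ≫ e₁) ≫ u := by simp [hx]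
    have hy' : y ≫ q = (e₂ ≫ e₁) ≫ v := by simp [hy]
    have h₁ : Related R (e₂ ≫ x) y := related_of_directImage hR hK inf_le_left (by
      rw [hx', hy']
      exact Related.comp hu _)
    have h₂ : Related S (e₂ ≫ x) y := related_of_directImage hS hK inf_le_right (by
      rw [hx', hy']
      exact Related.comp hv _)
    have h₃ := (related_of_isKernelPair hK).1 ((Subobject.inf_factors _).2 ⟨h₁, h₂⟩)
    rw [hx', hy'] at h₃
    have := epi_comp e₂ e₁
    rwa [cancel_epi] at h₃
  · rintro T ⟨hT, Y, q, hq, hK, hc⟩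
    refine Subobject.le_of_factors ?_
    have hW : (R ⊓ S).arrow = prod.lift (relFst (R ⊓ S)) (relSnd (R ⊓ S)) := by ext <;> simp
    have hf : ∀ {U : Subobject (X ⨯ X)}, U.Factors (R ⊓ S).arrow →
        Related (directImage q U) (relFst (R ⊓ S) ≫ q) (relSnd (R ⊓ S) ≫ q) := fun h =>
      (related_directImage_iff _ _ _ _).2
        ⟨_, 𝟙 _, relFst (R ⊓ S), relSnd (R ⊓ S), inferInstance, by rwa [Related, ← hW], by simp, by simp⟩
    rw [hW]
    exact (related_of_isKernelPair hK).2 (hc.eq_of_related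
      (isEquivRel_of_related_id (directImage_refl q hR))
      (isEquivRel_of_related_id (directImage_refl q hS))
      (hf (Subobject.inf_arrow_factors_left R S)) (hf (Subobject.inf_arrow_factors_right R S)))

end Smith

/-! ### Unitality and additions on an object -/

section Unital

variable {C : Type u} [Category.{v} C] [Maltsev C] [HasZeroMorphisms C]

/-- Pointed Mal'tsev categories are unital: a subobject of `A ⨯ B` containing both axes is the
whole of `A ⨯ B`. -/
theorem factors_of_axes {A B : C} {M : Subobject (A ⨯ B)} (hA : M.Factors (prod.lift (𝟙 A) 0))
    (hB : M.Factors (prod.lift 0 (𝟙 B))) {T : C} (f : T ⟶ A ⨯ B) : M.Factors f := by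
  have h₁ : M.Factors (prod.lift (f ≫ prod.fst) 0) := by
    simpa using Related.comp hA (f ≫ prod.fst)
  have h₂ : M.Factors (prod.lift 0 (f ≫ prod.snd)) := by
    simpa using Related.comp hB (f ≫ prod.snd)
  have h₃ : M.Factors (prod.lift (0 : T ⟶ A) (0 : T ⟶ B)) := by
    simpa using Related.comp hA (0 : T ⟶ A)
  have h := difunctional h₁ h₃ h₂
  have hf : f = prod.lift (f ≫ prod.fst) (f ≫ prod.snd) := by ext <;> simp
  rwa [hf]

theorem hom_ext_of_axes {A B Z : C} {f g : A ⨯ B ⟶ Z}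
    (hA : prod.lift (𝟙 A) 0 ≫ f = prod.lift (𝟙 A) 0 ≫ g)
    (hB : prod.lift 0 (𝟙 B) ≫ f = prod.lift 0 (𝟙 B) ≫ g) : f = g := by
  have h := factors_of_axes ((equalizerSubobject_factors_iff f g _).2 hA)
    ((equalizerSubobject_factors_iff f g _).2 hB) (𝟙 _)
  simpa using (equalizerSubobject_factors_iff f g _).1 h

section Multiplication

variable {A : C} {φ : A ⨯ A ⟶ A} (h₁ : prod.lift (𝟙 A) 0 ≫ φ = 𝟙 A)
  (h₂ : prod.lift 0 (𝟙 A) ≫ φ = 𝟙 A)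

include h₁ in
theorem lift_zero_right_comp {T : C} (x : T ⟶ A) : prod.lift x 0 ≫ φ = x := by
  have : prod.lift x (0 : T ⟶ A) = x ≫ prod.lift (𝟙 A) 0 := by ext <;> simp
  rw [this, Category.assoc, h₁, Category.comp_id]

include h₂ in
theorem lift_zero_left_comp {T : C} (x : T ⟶ A) : prod.lift 0 x ≫ φ = x := by
  have : prod.lift (0 : T ⟶ A) x = x ≫ prod.lift 0 (𝟙 A) := by ext <;> simp
  rw [this, Category.assoc, h₂, Category.comp_id]

include h₁ h₂ in
theorem lift_comp_comm {T : C} (x y : T ⟶ A) : prod.lift x y ≫ φ = prod.lift y x ≫ φ := by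
  have h : φ = prod.lift prod.snd prod.fst ≫ φ := by
    apply hom_ext_of_axes <;>
      simp [h₁, h₂, prod.comp_lift_assoc]
  conv_lhs => rw [h]
  simp [prod.comp_lift_assoc]

include h₁ h₂ in
theorem lift_comp_assoc {T : C} (x y z : T ⟶ A) :
    prod.lift (prod.lift x y ≫ φ) z ≫ φ = prod.lift x (prod.lift y z ≫ φ) ≫ φ := by
  have h : prod.lift (prod.lift prod.fst (prod.snd ≫ prod.fst) ≫ φ) (prod.snd ≫ prod.snd) ≫ φ =
      prod.lift prod.fst (prod.snd ≫ φ : A ⨯ (A ⨯ A) ⟶ A) ≫ φ := by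
    apply hom_ext_of_axes <;>
      simp [lift_zero_right_comp h₁, lift_zero_left_comp h₂, prod.comp_lift_assoc]
  have := congrArg (prod.lift x (prod.lift y z) ≫ ·) h
  simpa [prod.comp_lift_assoc] using this

include h₂ in
theorem lift_comp_cancel {T : C} {x y z : T ⟶ A}
    (h : prod.lift x y ≫ φ = prod.lift x z ≫ φ) : y = z := by
  -- View `x + y = x + z` as a relation between `x` and `(y, z)`. It holds at `(0, (0, 0))` and `(x,
  -- (0, 0))`, so difunctionality replaces `x` by `0`.
  let E := equalizerSubobject (prod.lift prod.fst (prod.snd ≫ prod.fst) ≫ φ)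
    (prod.lift prod.fst (prod.snd ≫ prod.snd) ≫ φ : A ⨯ (A ⨯ A) ⟶ A)
  have key : ∀ x y z : T ⟶ A, E.Factors (prod.lift x (prod.lift y z)) ↔
      prod.lift x y ≫ φ = prod.lift x z ≫ φ := fun x y z => by
    rw [equalizerSubobject_factors_iff]
    simp [prod.comp_lift_assoc]
  have h := (key 0 y z).1
    (difunctional ((key 0 0 0).2 rfl) ((key x 0 0).2 rfl) ((key x y z).2 h))
  simpa [lift_zero_left_comp h₂] using h

include h₁ h₂ in
theorem exists_inverse : ∃ i : A ⟶ A, prod.lift (𝟙 A) i ≫ φ = 0 := by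
  -- The shear `(x, y) ↦ (x, x + y)` is monic by cancellation. Its image contains `(x, x)`, `(0, x)`
  -- and `(0, 0)`, hence `(x, 0)`, whose preimage supplies the inverse.
  obtain ⟨s, s_eq⟩ : ∃ s : A ⨯ A ⟶ A ⨯ A, s = prod.lift prod.fst φ := ⟨_, rfl⟩
  have hs : Mono s := ⟨fun f g h => by
    have hf : ∀ {T : C} (f : T ⟶ A ⨯ A), prod.lift (f ≫ prod.fst) (f ≫ prod.snd) = f :=
      fun f => by ext <;> simp
    have e₁ : f ≫ prod.fst = g ≫ prod.fst := by simpa [s_eq] using congrArg (· ≫ prod.fst) h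
    have e₂ : f ≫ φ = g ≫ φ := by simpa [s_eq] using congrArg (· ≫ prod.snd) h
    rw [← hf f, ← hf g, ← e₁] at e₂
    ext
    · exact e₁
    · exact lift_comp_cancel h₂ e₂⟩
  have key : ∀ x y : A ⟶ A, (Subobject.mk s).Factors (prod.lift x (prod.lift x y ≫ φ)) :=
    fun x y => (Subobject.mk_factors_iff _ _).2
      ⟨prod.lift x y, by simp [s_eq, prod.comp_lift]⟩
  have k₁ := key (𝟙 A) 0
  have k₂ := key 0 (𝟙 A)
  have k₃ := key 0 0
  rw [lift_zero_right_comp h₁] at k₁ k₃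
  rw [lift_zero_left_comp h₂] at k₂
  obtain ⟨g, hg⟩ : ∃ g : A ⟶ A ⨯ A, g ≫ s = prod.lift (𝟙 A) 0 :=
    (Subobject.mk_factors_iff _ _).1 (difunctional k₁ k₂ k₃)
  have e₁ : g ≫ prod.fst = 𝟙 A := by simpa [s_eq] using congrArg (· ≫ prod.fst) hg
  have e₂ : g ≫ φ = 0 := by simpa [s_eq] using congrArg (· ≫ prod.snd) hg
  refine ⟨g ≫ prod.snd, ?_⟩
  have : prod.lift (𝟙 A) (g ≫ prod.snd) = g := by ext <;> simp [e₁]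
  rw [this, e₂]

end Multiplication

end Unital

/-! ### Abelian objects vanish -/

section Abelian

variable {C : Type u} [Category.{v} C] [Arithmetical C] [HasZeroObject C] [HasZeroMorphisms C]

theorem IsAbelianObject.isZero {A : C} (hA : IsAbelianObject A) : IsZero A := by
  obtain ⟨φ, h₁, h₂⟩ := hA
  obtain ⟨Z, hZ⟩ := HasZeroObject.zero (C := C)
  obtain ⟨i, hi⟩ := exists_inverse h₁ h₂
  have : Mono (0 : A ⟶ Z) :=
    mono_of_fibrewise_group (0 : A ⟶ Z) 0 i (fun f g _ => prod.lift f g ≫ φ)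
      (fun u f g _ => by simp [prod.comp_lift_assoc]) (hZ.eq_of_src _ _) (by simp)
      (fun f g _ => by simp) (by simp [h₂]) (by simp [h₁]) (by simp [hi])
      (by rw [lift_comp_comm h₁ h₂, hi, zero_comp])
      (fun f g k _ _ => lift_comp_assoc h₁ h₂ f g k)
  rw [IsZero.iff_id_eq_zero, ← cancel_mono (0 : A ⟶ Z)]
  simp

end Abelian

/-! ### Higgins commutators of normal subobjects -/

section Higgins

variable {C : Type u} [Category.{v} C] [Arithmetical C] [HasZeroMorphisms C]

theorem strongEpi_of_factors_axes {A B S : C} (f : S ⟶ A ⨯ B)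
    (hA : (imageSubobject f).Factors (prod.lift (𝟙 A) 0))
    (hB : (imageSubobject f).Factors (prod.lift 0 (𝟙 B))) : StrongEpi f := by
  obtain ⟨T, e, x, he, hx⟩ :=
    (factors_imageSubobject_iff f _).1 (factors_of_axes hA hB (𝟙 (A ⨯ B)))
  have : StrongEpi (x ≫ f) := by simpa [hx] using he
  exact strongEpi_of_strongEpi x f

variable [HasZeroObject C]

/-- A relation from `X` to `X ⨯ X` containing all `(x, (x, 0))` and `(x, (0, x))` contains all
`(x, (0, 0))`. -/
theorem factors_zero_of_factors {X : C} {M : Subobject (X ⨯ (X ⨯ X))}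
    (h₁ : M.Factors (prod.lift (𝟙 X) (prod.lift (𝟙 X) 0)))
    (h₂ : M.Factors (prod.lift (𝟙 X) (prod.lift 0 (𝟙 X)))) :
    M.Factors (prod.lift (𝟙 X) 0) := by
  have g₁ : ∀ {T : C} (x : T ⟶ X), M.Factors (prod.lift x (prod.lift x 0)) := fun x => by
    simpa [prod.comp_lift] using Related.comp h₁ x
  have g₂ : ∀ {T : C} (x : T ⟶ X), M.Factors (prod.lift x (prod.lift 0 x)) := fun x => by
    simpa [prod.comp_lift] using Related.comp h₂ x
  -- `V` relates `x` to `y` when `(y, (x, 0))` lies in `M`. The goal says that `V` relates `0` to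
  -- everything, so it suffices that the quotient by `V` is zero.
  let V : Subobject (X ⨯ X) :=
    (Subobject.pullback (prod.lift prod.snd (prod.lift prod.fst 0))).obj M
  have hV : ∀ {T : C} (x y : T ⟶ X),
      Related V x y ↔ M.Factors (prod.lift y (prod.lift x 0)) := fun x y => by
    rw [Related, pullback_factors_iff]
    simp [prod.comp_lift]
  have hVe : IsEquivRel V := isEquivRel_of_related_id ((hV _ _).2 h₁)
  obtain ⟨Q, q, hq, hK⟩ := exists_quotient hVe
  let r : (M : C) ⟶ X ⨯ X := M.arrow ≫ prod.snd
  have hr : StrongEpi r := by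
    apply strongEpi_of_factors_axes
    · have : prod.lift (𝟙 X) 0 = M.factorThru _ h₁ ≫ r := by simp [r]
      rw [this]
      exact imageSubobject_factors_comp_self _ _
    · have : prod.lift 0 (𝟙 X) = M.factorThru _ h₂ ≫ r := by simp [r]
      rw [this]
      exact imageSubobject_factors_comp_self _ _
  -- Modulo `V`, the first coordinate of a member of `M` depends only on the second: from `(a, w)`,
  -- `(b, w)` and `(b, (b, 0))` in `M`, difunctionality gives `(a, (b, 0))`.
  obtain ⟨ψ, hψ⟩ := exists_desc_of_strongEpi r (M.arrow ≫ prod.fst ≫ q) (by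
    intro T x y hxy
    have hx := factors_lift_arrow M x
    have hy := factors_lift_arrow M y
    rw [show x ≫ M.arrow ≫ prod.snd = y ≫ M.arrow ≫ prod.snd from hxy] at hx
    simpa using ((related_of_isKernelPair hK).1
      ((hV _ _).2 (difunctional hx hy (g₁ (y ≫ M.arrow ≫ prod.fst))))).symm)
  have ψ₁ : ∀ {T : C} (x : T ⟶ X), prod.lift x 0 ≫ ψ = x ≫ q := fun x => by
    have : prod.lift x 0 = M.factorThru _ (g₁ x) ≫ r := by simp [r]
    rw [this, Category.assoc, hψ]
    simp
  have ψ₂ : ∀ {T : C} (x : T ⟶ X), prod.lift 0 x ≫ ψ = x ≫ q := fun x => by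
    have : prod.lift 0 x = M.factorThru _ (g₂ x) ≫ r := by simp [r]
    rw [this, Category.assoc, hψ]
    simp
  have hVV : prod.map (relFst V) (relFst V) ≫ ψ = prod.map (relSnd V) (relSnd V) ≫ ψ := by
    have hw : V.arrow ≫ prod.fst ≫ q = V.arrow ≫ prod.snd ≫ q := by simpa using hK.w
    apply hom_ext_of_axes <;> simp [prod.lift_map_assoc, ψ₁, ψ₂, hw]
  -- As `ψ` restricts to `q` on both axes, its descent is an addition on `Q`.
  obtain ⟨φ, hφ⟩ := exists_desc_of_strongEpi (prod.map q q) ψ (by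
    intro T x y hxy
    have k₁ : Related V (x ≫ prod.fst) (y ≫ prod.fst) := (related_of_isKernelPair hK).2 (by
      simpa using congrArg (· ≫ prod.fst) hxy)
    have k₂ : Related V (x ≫ prod.snd) (y ≫ prod.snd) := (related_of_isKernelPair hK).2 (by
      simpa using congrArg (· ≫ prod.snd) hxy)
    have h := congrArg (prod.lift (V.factorThru _ k₁) (V.factorThru _ k₂) ≫ ·) hVV
    have e : ∀ z : T ⟶ X ⨯ X, prod.lift (z ≫ prod.fst) (z ≫ prod.snd) = z :=
      fun z => by ext <;> simp
    simpa [prod.lift_map_assoc, e] using h)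
  have hQ : IsAbelianObject Q := by
    refine ⟨φ, ?_, ?_⟩
    · rw [← cancel_epi q]
      have : q ≫ prod.lift (𝟙 Q) 0 = prod.lift (𝟙 X) 0 ≫ prod.map q q := by ext <;> simp
      rw [reassoc_of% this, hφ, ψ₁]
      simp
    · rw [← cancel_epi q]
      have : q ≫ prod.lift 0 (𝟙 Q) = prod.lift 0 (𝟙 X) ≫ prod.map q q := by ext <;> simp
      rw [reassoc_of% this, hφ, ψ₂]
      simp
  have h := (hV 0 (𝟙 X)).1 ((related_of_isKernelPair hK).2 (hQ.isZero.eq_of_tgt _ _))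
  have h0 : prod.lift (0 : X ⟶ X) (0 : X ⟶ X) = 0 := by ext <;> simp
  rwa [h0] at h

variable [HasBinaryCoproducts C]

theorem factors_higginsCommutator {D X : C} {K L : Subobject D} (i : X ⟶ K) (j : X ⟶ L)
    (hij : i ≫ K.arrow = j ≫ L.arrow) : (higginsCommutator K L).Factors (i ≫ K.arrow) := by
  -- `ρ` pairs the codiagonal with the comparison map. A point `(x, (0, 0))` of its image lifts,
  -- over a cover, to an element of the kernel of the comparison that folds to `x`.
  let ρ : X ⨿ X ⟶ X ⨯ (X ⨯ X) := coprod.desc (prod.lift (𝟙 X) (prod.lift (𝟙 X) 0))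
    (prod.lift (𝟙 X) (prod.lift 0 (𝟙 X)))
  have h₁ : (imageSubobject ρ).Factors (prod.lift (𝟙 X) (prod.lift (𝟙 X) 0)) := by
    have := imageSubobject_factors_comp_self ρ coprod.inl
    rwa [coprod.inl_desc] at this
  have h₂ : (imageSubobject ρ).Factors (prod.lift (𝟙 X) (prod.lift 0 (𝟙 X))) := by
    have := imageSubobject_factors_comp_self ρ coprod.inr
    rwa [coprod.inr_desc] at this
  obtain ⟨S, e, x, he, hx⟩ :=
    (factors_imageSubobject_iff ρ _).1 (factors_zero_of_factors h₁ h₂)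
  have hx₁ : x ≫ coprod.desc (𝟙 X) (𝟙 X) = e := by
    have h : ρ ≫ prod.fst = coprod.desc (𝟙 X) (𝟙 X) := by ext <;> simp [ρ]
    rw [← h, reassoc_of% hx]
    simp
  have hx₂ : x ≫ coprod.desc (prod.lift (𝟙 X) 0) (prod.lift 0 (𝟙 X)) = 0 := by
    have h : ρ ≫ prod.snd = coprod.desc (prod.lift (𝟙 X) 0) (prod.lift 0 (𝟙 X)) := by
      apply coprod.hom_ext <;> simp [ρ]
    rw [← h, reassoc_of% hx]
    simp
  let c := coprod.desc (prod.lift (𝟙 (K : C)) (0 : (K : C) ⟶ (L : C)))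
    (prod.lift (0 : (L : C) ⟶ (K : C)) (𝟙 (L : C)))
  have hc : (x ≫ coprod.map i j) ≫ c = 0 := by
    have h : coprod.map i j ≫ c =
        coprod.desc (prod.lift (𝟙 X) 0) (prod.lift 0 (𝟙 X)) ≫ prod.map i j := by
      apply coprod.hom_ext <;> ext <;> simp [c]
    rw [Category.assoc, h, reassoc_of% hx₂, zero_comp]
  refine (factors_imageSubobject_iff _ _).2 ⟨S, e, kernel.lift c _ hc, he, ?_⟩
  have hd : coprod.map i j ≫ coprod.desc K.arrow L.arrow =
      coprod.desc (𝟙 X) (𝟙 X) ≫ i ≫ K.arrow := by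
    apply coprod.hom_ext <;> simp [hij]
  rw [kernel.lift_ι_assoc, Category.assoc, hd, reassoc_of% hx₁]

theorem le_higginsCommutator {D : C} (K L : Subobject D) : K ⊓ L ≤ higginsCommutator K L := by
  refine Subobject.le_of_factors ?_
  simpa using factors_higginsCommutator (Subobject.ofLE (K ⊓ L) K inf_le_left)
    (Subobject.ofLE (K ⊓ L) L inf_le_right) (by simp)

omit [HasZeroObject C] in
theorem higginsCommutator_le_left {D : C} {K L : Subobject D} (hK : IsNormalSubobject K) :
    higginsCommutator K L ≤ K := by
  obtain ⟨E, f, rfl⟩ := hK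
  set K := kernelSubobject f
  -- As `f` kills `K`, this composite factors through the comparison map and so vanishes on its
  -- kernel.
  have h : coprod.desc K.arrow L.arrow ≫ f =
      coprod.desc (prod.lift (𝟙 (K : C)) (0 : (K : C) ⟶ (L : C)))
        (prod.lift (0 : (L : C) ⟶ (K : C)) (𝟙 (L : C))) ≫ prod.snd ≫ L.arrow ≫ f := by
    apply coprod.hom_ext <;> simp [K]
  refine imageSubobject_le _ (K.factorThru _ ((kernelSubobject_factors_iff f _).2 ?_))
    (Subobject.factorThru_arrow _ _ _)
  rw [Category.assoc, h, kernel.condition_assoc, zero_comp]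

omit [HasZeroObject C] in
theorem higginsCommutator_le_right {D : C} {K L : Subobject D} (hL : IsNormalSubobject L) :
    higginsCommutator K L ≤ L := by
  obtain ⟨E, f, rfl⟩ := hL
  set L := kernelSubobject f
  have h : coprod.desc K.arrow L.arrow ≫ f =
      coprod.desc (prod.lift (𝟙 (K : C)) (0 : (K : C) ⟶ (L : C)))
        (prod.lift (0 : (L : C) ⟶ (K : C)) (𝟙 (L : C))) ≫ prod.fst ≫ K.arrow ≫ f := by
    apply coprod.hom_ext <;> simp [L]
  refine imageSubobject_le _ (L.factorThru _ ((kernelSubobject_factors_iff f _).2 ?_))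
    (Subobject.factorThru_arrow _ _ _)
  rw [Category.assoc, h, kernel.condition_assoc, zero_comp]

end Higgins

/-! ### Normalisation and the Smith is Huq condition -/

section SmithIsHuq

variable {C : Type u} [Category.{v} C] [Arithmetical C] [HasZeroObject C] [HasZeroMorphisms C]

theorem HuqCommute.isZero_inf {X : C} {K L : Subobject X} (h : HuqCommute K.arrow L.arrow) :
    IsZero ((K ⊓ L : Subobject X) : C) := by
  obtain ⟨φ, h₁, h₂⟩ := h
  let I := K ⊓ L
  let χ := prod.map (Subobject.ofLE I K inf_le_left) (Subobject.ofLE I L inf_le_right) ≫ φ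
  have e₁ : prod.lift (𝟙 (I : C)) 0 ≫ χ = I.arrow := by
    have : prod.lift (𝟙 (I : C)) 0 ≫ prod.map (Subobject.ofLE I K inf_le_left)
        (Subobject.ofLE I L inf_le_right) =
        Subobject.ofLE I K inf_le_left ≫ prod.lift (𝟙 _) 0 := by ext <;> simp
    rw [reassoc_of% this, h₁, Subobject.ofLE_arrow]
  have e₂ : prod.lift 0 (𝟙 (I : C)) ≫ χ = I.arrow := by
    have : prod.lift 0 (𝟙 (I : C)) ≫ prod.map (Subobject.ofLE I K inf_le_left)
        (Subobject.ofLE I L inf_le_right) =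
        Subobject.ofLE I L inf_le_right ≫ prod.lift 0 (𝟙 _) := by ext <;> simp
    rw [reassoc_of% this, h₂, Subobject.ofLE_arrow]
  -- The inverse image of `I` along `χ` contains both axes, hence is everything; so `χ` restricts to
  -- an addition on `I`.
  have hχ : I.Factors χ := by
    have := factors_of_axes
      ((pullback_factors_iff χ I (prod.lift (𝟙 _) 0)).2 (e₁ ▸ Subobject.factors_self I))
      ((pullback_factors_iff χ I (prod.lift 0 (𝟙 _))).2 (e₂ ▸ Subobject.factors_self I)) (𝟙 _)
    simpa using (pullback_factors_iff χ I _).1 this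
  refine IsAbelianObject.isZero ⟨I.factorThru χ hχ, ?_, ?_⟩
  · rw [← cancel_mono I.arrow]
    simp only [Category.assoc, Subobject.factorThru_arrow, Category.id_comp]
    exact e₁
  · rw [← cancel_mono I.arrow]
    simp only [Category.assoc, Subobject.factorThru_arrow, Category.id_comp]
    exact e₂

omit [HasZeroObject C] in
theorem normalisation_inf {X : C} (R S : Subobject (X ⨯ X)) :
    normalisation (R ⊓ S) = normalisation R ⊓ normalisation S :=
  Subobject.inf_pullback _ _ _

/-- In a protomodular category an equivalence relation with trivial normalisation is discrete. -/
theorem IsEquivRel.eq_of_isZero_normalisation {X : C} (hC : Protomodular C)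
    {R : Subobject (X ⨯ X)} (hR : IsEquivRel R) (h : IsZero (normalisation R : C)) {T : C}
    {x y : T ⟶ X} (hxy : Related R x y) : x = y := by
  obtain ⟨Z, hZ⟩ := HasZeroObject.zero (C := C)
  let δ : X ⟶ R := R.factorThru _ (hR.refl (𝟙 X))
  have hδ₁ : δ ≫ relFst R = 𝟙 X := by simp [δ]
  have hδ₂ : δ ≫ relSnd R = 𝟙 X := by simp [δ]
  have hiso : IsIso δ := by
    -- Regard the diagonal as a map of points over `X`. Pulled back along `0 ⟶ X`, it becomes a map
    -- between zero objects.
    refine hC (0 : Z ⟶ X) (𝟙 X) (𝟙 X) (relFst R) δ (by simp) hδ₁ δ hδ₁ (by simp) ?_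
    have z₁ : IsZero (pullback (0 : Z ⟶ X) (𝟙 X)) := by
      rw [IsZero.iff_id_eq_zero]
      apply pullback.hom_ext
      · exact hZ.eq_of_tgt _ _
      · have := pullback.condition (f := (0 : Z ⟶ X)) (g := 𝟙 X)
        simpa using this.symm
    have z₂ : IsZero (pullback (0 : Z ⟶ X) (relFst R)) := by
      rw [IsZero.iff_id_eq_zero]
      apply pullback.hom_ext
      · exact hZ.eq_of_tgt _ _
      · have hc : pullback.snd (0 : Z ⟶ X) (relFst R) ≫ relFst R = 0 := by
          simp [← pullback.condition]
        have hn : (normalisation R).Factors (pullback.snd (0 : Z ⟶ X) (relFst R) ≫ relSnd R) := by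
          rw [normalisation, pullback_factors_iff, prod.comp_lift, comp_zero, ← hc]
          simpa using factors_lift_arrow R (pullback.snd (0 : Z ⟶ X) (relFst R))
        have hs : pullback.snd (0 : Z ⟶ X) (relFst R) ≫ relSnd R = 0 := by
          rw [← (normalisation R).factorThru_arrow _ hn, h.eq_of_tgt (Subobject.factorThru _ _ hn) 0,
            zero_comp]
        apply rel_hom_ext
        · simpa using hc
        · simpa using hs
    exact z₁.isIso z₂ _
  have hs : relFst R = relSnd R := by
    rw [← cancel_epi δ, hδ₁, hδ₂]
  have := congrArg (R.factorThru _ hxy ≫ ·) hs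
  simpa using this

theorem smithIsHuq_of_protomodular (hC : Protomodular C) : SmithIsHuq C := by
  intro X R S hR hS h
  have hz := h.isZero_inf
  rw [← normalisation_inf] at hz
  exact centralise_of_inf_trivial hR hS fun x y h₁ h₂ =>
    (hR.inf hS).eq_of_isZero_normalisation hC hz ((Subobject.inf_factors _).2 ⟨h₁, h₂⟩)

end SmithIsHuq

end SmithHuq

theorem mainTheorem9 {C : Type u} [Category.{v} C] [SmithHuq.Arithmetical C] :
    -- Smith commutators of equivalence relations are intersections
    (∀ {X : C} (R S : Subobject (X ⨯ X)), SmithHuq.IsEquivRel R → SmithHuq.IsEquivRel S →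
      SmithHuq.IsSmithCommutator R S (R ⊓ S)) ∧
    ∀ [HasZeroObject C] [HasZeroMorphisms C],
      -- the only abelian object is the zero object
      (∀ A : C, SmithHuq.IsAbelianObject A → IsZero A) ∧
      ∀ [HasBinaryCoproducts C],
        -- Higgins commutators of normal subobjects are intersections
        (∀ {D : C} (K L : Subobject D), SmithHuq.IsNormalSubobject K →
          SmithHuq.IsNormalSubobject L → SmithHuq.higginsCommutator K L = K ⊓ L) ∧
        -- normalisation preserves intersections
        (∀ {X : C} (R S : Subobject (X ⨯ X)), SmithHuq.IsEquivRel R → SmithHuq.IsEquivRel S →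
          SmithHuq.normalisation (R ⊓ S) = SmithHuq.normalisation R ⊓ SmithHuq.normalisation S) ∧
        -- the Smith is Huq condition
        (SmithHuq.Protomodular C → SmithHuq.SmithIsHuq C) := by
  refine ⟨fun R S hR hS => SmithHuq.isSmithCommutator_inf hR hS, ?_⟩
  intro _ _
  refine ⟨fun A hA => hA.isZero, ?_⟩
  intro _
  exact ⟨fun K L hK hL => le_antisymm
      (le_inf (SmithHuq.higginsCommutator_le_left hK) (SmithHuq.higginsCommutator_le_right hL))
      (SmithHuq.le_higginsCommutator K L),
    fun R S _ _ => SmithHuq.normalisation_inf R S, SmithHuq.smithIsHuq_of_protomodular⟩
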